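/- Let $G=(V,E,c)$ be a weighted graph with finite vertex set $V$, $|V|=n$, finite edge set $E$, $|E|=m$, and edge weights $c_e\ge 0$ (parallel edges and loops are allowed, and $G$ need not be connected). Orient the edges arbitrarily and let $B\in\mathbb{R}^{E\times V}$ be the signed edge-vertex incidence matrix, whose row at an edge $e=uv$ is $b_u-b_v$, where $b_x$ denotes the indicator vector of the vertex $x$. Let $C\in\mathbb{R}^{E\times E}$ be the diagonal matrix of the edge weights, $L=B^{T}CB$ the Laplacian matrix of $G$, and $L^{+}$ its Moore--Penrose pseudoinverse. The weighted transfer impedance matrix of $G$ is the $m\times m$ matrix $$\Pi = C^{1/2}BL^{+}B^{T}C^{1/2}.$$ Let $\overline{\Pi}$ be the matrix of entrywise absolute values of $\Pi$, that is, $\overline{\Pi}(e,f)=|\Pi(e,f)|$, and let $\|\cdot\|$ be the spectral norm ($\ell^2$ operator norm). Theorem. There is an absolute constant $K$ such that for every such weighted graph $G$, $$\|\overline{\Pi}\|\le K\,(\log n)^2 .$$ -/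

import Mathlib

open scoped Matrix Matrix.Norms.L2Operator

/-- `X` satisfies the four Penrose equations for the real matrix `A`. -/
structure IsMoorePenroseInverse {m n : Type*} [Fintype m] [Fintype n]
    (A : Matrix m n ℝ) (X : Matrix n m ℝ) : Prop where
  mul_mul_self : A * X * A = A
  mul_self_mul : X * A * X = X
  symm_left : (A * X)ᵀ = A * X
  symm_right : (X * A)ᵀ = X * A

/-- The Moore–Penrose inverse is unique. -/
theorem IsMoorePenroseInverse.unique {m n : Type*} [Fintype m] [Fintype n]
    {A : Matrix m n ℝ} {X Y : Matrix n m ℝ}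
    (hX : IsMoorePenroseInverse A X) (hY : IsMoorePenroseInverse A Y) : X = Y := by
  have h1 : A * X = A * Y := by
    calc A * X = (A * X)ᵀ := hX.symm_left.symm
      _ = (A * Y * (A * X))ᵀ := by
          rw [← Matrix.mul_assoc (A * Y) A X, hY.mul_mul_self]
      _ = A * X * (A * Y) := by rw [Matrix.transpose_mul, hX.symm_left, hY.symm_left]
      _ = A * Y := by rw [← Matrix.mul_assoc (A * X) A Y, hX.mul_mul_self]
  have h2 : X * A = Y * A := by
    calc X * A = (X * A)ᵀ := hX.symm_right.symm
      _ = (X * A * (Y * A))ᵀ := by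
          rw [Matrix.mul_assoc X A, ← Matrix.mul_assoc A Y A, hY.mul_mul_self]
      _ = Y * A * (X * A) := by rw [Matrix.transpose_mul, hX.symm_right, hY.symm_right]
      _ = Y * A := by
          rw [Matrix.mul_assoc Y A, ← Matrix.mul_assoc A X A, hX.mul_mul_self]
  calc X = X * A * X := hX.mul_self_mul.symm
    _ = Y * A * Y := by rw [h2, Matrix.mul_assoc, h1, ← Matrix.mul_assoc]
    _ = Y := hY.mul_self_mul

/-- Every real matrix has a Moore–Penrose inverse. -/
theorem exists_isMoorePenroseInverse {m n : Type*} [Fintype m] [Fintype n]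
    (A : Matrix m n ℝ) : ∃ X, IsMoorePenroseInverse A X := by
  classical
  have hS : (Aᵀ * A).IsHermitian := by
    simpa [Matrix.conjTranspose_eq_transpose_of_trivial] using
      Matrix.isHermitian_conjTranspose_mul_self A
  set S : Matrix n n ℝ := Aᵀ * A with hSdef
  -- a symmetric `P` with `S P S = S`, `P S P = P` and `P S = S P`, by diagonalising `S`
  obtain ⟨P, hPt, h1, h2, h3⟩ : ∃ P : Matrix n n ℝ,
      Pᵀ = P ∧ S * P * S = S ∧ P * S * P = P ∧ P * S = S * P := by
    set φ := Unitary.conjStarAlgAut ℝ (Matrix n n ℝ) hS.eigenvectorUnitary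
    set d : n → ℝ := hS.eigenvalues
    have hSφ : S = φ (Matrix.diagonal d) := hS.spectral_theorem
    refine ⟨φ (Matrix.diagonal fun i => (d i)⁻¹), ?_, ?_, ?_, ?_⟩
    · rw [← Matrix.conjTranspose_eq_transpose_of_trivial, ← Matrix.star_eq_conjTranspose,
        ← map_star, Matrix.star_eq_conjTranspose, Matrix.diagonal_conjTranspose]
      congr 1
    · rw [hSφ, ← map_mul, ← map_mul, Matrix.diagonal_mul_diagonal,
        Matrix.diagonal_mul_diagonal]
      simp only [mul_inv_mul_cancel]
    · rw [hSφ, ← map_mul, ← map_mul, Matrix.diagonal_mul_diagonal,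
        Matrix.diagonal_mul_diagonal]
      congr 2
      funext i
      by_cases h : d i = 0
      · simp [h]
      · rw [inv_mul_cancel₀ h, one_mul]
    · rw [hSφ, ← map_mul, ← map_mul, Matrix.diagonal_mul_diagonal,
        Matrix.diagonal_mul_diagonal]
      simp only [mul_comm]
  have hSt : Sᵀ = S := by rw [hSdef, Matrix.transpose_mul, Matrix.transpose_transpose]
  have hA : A * (P * S) = A := by
    have h0 : (A * (P * S) - A)ᴴ * (A * (P * S) - A) = 0 := by
      have e1 : Aᵀ * (A * (P * S) - A) = 0 := by
        rw [Matrix.mul_sub, ← Matrix.mul_assoc, ← hSdef, ← Matrix.mul_assoc, h1, sub_self]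
      have e2 : (A * (P * S) - A)ᵀ = (S * P - 1) * Aᵀ := by
        rw [Matrix.transpose_sub, Matrix.transpose_mul, Matrix.transpose_mul, hPt, hSt,
          Matrix.sub_mul, Matrix.one_mul]
      rw [Matrix.conjTranspose_eq_transpose_of_trivial, e2, Matrix.mul_assoc, e1,
        Matrix.mul_zero]
    exact sub_eq_zero.mp (Matrix.conjTranspose_mul_self_eq_zero.mp h0)
  refine ⟨P * Aᵀ, ?_, ?_, ?_, ?_⟩
  · rw [Matrix.mul_assoc, Matrix.mul_assoc P, ← hSdef, hA]
  · rw [Matrix.mul_assoc P Aᵀ A, ← hSdef, ← Matrix.mul_assoc, h2]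
  · rw [Matrix.transpose_mul, Matrix.transpose_mul, Matrix.transpose_transpose, hPt,
      Matrix.mul_assoc]
  · rw [Matrix.mul_assoc, ← hSdef, Matrix.transpose_mul, hPt, hSt, h3]

/-- The Moore–Penrose inverse `A⁺` of a real matrix. -/
noncomputable def pseudoInverse {m n : Type*} [Fintype m] [Fintype n]
    (A : Matrix m n ℝ) : Matrix n m ℝ :=
  Classical.choose (exists_isMoorePenroseInverse A)

theorem pseudoInverse_spec {m n : Type*} [Fintype m] [Fintype n] (A : Matrix m n ℝ) :
    IsMoorePenroseInverse A (pseudoInverse A) :=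
  Classical.choose_spec (exists_isMoorePenroseInverse A)

/-- A weighted graph with vertex set `V` and edge set `E`: every edge `e` joins `src e` and
`tgt e` (which is also its arbitrary orientation) and has a weight `c e ≥ 0`. Simple graphs are
included; parallel edges and loops are allowed, and the graph need not be connected. -/
structure WeightedGraph (V E : Type*) where
  src : E → V
  tgt : E → V
  c : E → ℝ
  c_nonneg : ∀ e, 0 ≤ c e

namespace WeightedGraph

/-- The signed edge-vertex incidence matrix `B`, whose row at an edge `e = uv` is
`b_u - b_v`. -/
def incidence {V E : Type*} [DecidableEq V] (G : WeightedGraph V E) : Matrix E V ℝ :=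
  Matrix.of fun e x => (if x = G.src e then 1 else 0) - (if x = G.tgt e then 1 else 0)

/-- The Laplacian `L = Bᵀ C B`, where `C` is the diagonal matrix of the edge weights. -/
def laplacian {V E : Type*} [DecidableEq V] [Fintype E] [DecidableEq E]
    (G : WeightedGraph V E) : Matrix V V ℝ :=
  G.incidenceᵀ * Matrix.diagonal G.c * G.incidence

/-- The diagonal matrix `C^{1/2}` of the square roots of the edge weights. -/
noncomputable def sqrtWeight {V E : Type*} [DecidableEq E]
    (G : WeightedGraph V E) : Matrix E E ℝ :=
  Matrix.diagonal fun e => Real.sqrt (G.c e)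

/-- The weighted transfer impedance matrix `Π = C^{1/2} B L⁺ Bᵀ C^{1/2}`. -/
noncomputable def transferImpedance {V E : Type*} [Fintype V] [DecidableEq V] [Fintype E]
    [DecidableEq E] (G : WeightedGraph V E) : Matrix E E ℝ :=
  G.sqrtWeight * G.incidence * pseudoInverse G.laplacian * G.incidenceᵀ * G.sqrtWeight

/-- The entrywise absolute value of the weighted transfer impedance matrix. -/
noncomputable def absTransferImpedance {V E : Type*} [Fintype V] [DecidableEq V] [Fintype E]
    [DecidableEq E] (G : WeightedGraph V E) : Matrix E E ℝ :=
  G.transferImpedance.map fun x => |x|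

end WeightedGraph

/-! With N = C^{1/2}B, Π is the orthogonal projection onto the column space of N, and it is peeled
off one dimension at a time. For a set S of grounded vertices let h_v be the hitting probability of
v, and g_v = N h_v. Releasing u ∈ S performs one Gram–Schmidt step on these gradients, so the
projection Q onto their span loses g_u g_uᵀ/|g_u|². Hence |Q| is entrywise at most the remaining
|Q'| plus |g_u||g_u|ᵀ/|g_u|².

No single u gives a good bound, but the average over S does: Σ_u ⟨|g_u|, x⟩²/|g_u|² ≤ 3 log(n+1)
|x|² (`sum_sq_abs_gradient_le`). This is Cauchy–Schwarz with edge weights h_u(src) + h_u(tgt) + 1/n.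
One factor is controlled by pairing L h_u with log(h_u + 1/n), which costs a logarithm; the other
because the h_u sum to at most 1. A set of size s therefore costs O(log n)/s, and summing over s =
n, …, 2 gives the second logarithm (`absForm_le`). -/

namespace WeightedGraph

/-! ### Energy form, and Π as a projection -/

/-- The weighted incidence matrix `C^{1/2} B`. -/
noncomputable def weightedIncidence {V E : Type*} [DecidableEq V] [Fintype E] [DecidableEq E]
    (G : WeightedGraph V E) : Matrix E V ℝ :=
  G.sqrtWeight * G.incidence

theorem laplacian_eq {V E : Type*} [DecidableEq V] [Fintype E] [DecidableEq E]
    (G : WeightedGraph V E) : G.laplacian = G.weightedIncidenceᵀ * G.weightedIncidence := by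
  have h : Matrix.diagonal G.c = G.sqrtWeight * G.sqrtWeight := by
    rw [sqrtWeight, Matrix.diagonal_mul_diagonal]
    congr 1
    funext e
    exact (Real.mul_self_sqrt (G.c_nonneg e)).symm
  have ht : G.sqrtWeightᵀ = G.sqrtWeight := Matrix.diagonal_transpose _
  rw [laplacian, weightedIncidence, Matrix.transpose_mul, ht, h]
  simp only [Matrix.mul_assoc]

section
variable {V E : Type*} [Fintype V] [DecidableEq V] [Fintype E] [DecidableEq E]
  (G : WeightedGraph V E)

theorem weightedIncidence_mulVec (p : V → ℝ) (e : E) :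
    (G.weightedIncidence *ᵥ p) e = √(G.c e) * (p (G.src e) - p (G.tgt e)) := by
  rw [weightedIncidence, ← Matrix.mulVec_mulVec, sqrtWeight, Matrix.mulVec_diagonal]
  congr 1
  simp [Matrix.mulVec, dotProduct, incidence, sub_mul, Finset.sum_sub_distrib]

theorem dotProduct_laplacian_mulVec (p q : V → ℝ) :
    p ⬝ᵥ G.laplacian *ᵥ q = (G.weightedIncidence *ᵥ p) ⬝ᵥ (G.weightedIncidence *ᵥ q) := by
  rw [laplacian_eq, ← Matrix.mulVec_mulVec, Matrix.dotProduct_mulVec, Matrix.vecMul_transpose]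

theorem transferImpedance_eq : G.transferImpedance =
    G.weightedIncidence * pseudoInverse G.laplacian * G.weightedIncidenceᵀ := by
  have ht : G.sqrtWeightᵀ = G.sqrtWeight := Matrix.diagonal_transpose _
  rw [transferImpedance, weightedIncidence, Matrix.transpose_mul, ht]
  simp only [Matrix.mul_assoc]

/-- With L = NᵀN and X = L⁺, the matrix (LX - 1)Nᵀ times its transpose contains the factor (LX - 1)L
= 0, so it vanishes. -/
theorem transpose_weightedIncidence_mul_transferImpedance :
    G.weightedIncidenceᵀ * G.transferImpedance = G.weightedIncidenceᵀ := by
  set N := G.weightedIncidence with hN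
  set X := pseudoInverse G.laplacian with hX
  have hL : G.laplacian = Nᵀ * N := G.laplacian_eq
  have h0 : (G.laplacian * X - 1) * G.laplacian = 0 := by
    rw [Matrix.sub_mul, (pseudoInverse_spec G.laplacian).mul_mul_self, Matrix.one_mul, sub_self]
  have h1 : ((G.laplacian * X - 1) * Nᵀ) * ((G.laplacian * X - 1) * Nᵀ)ᴴ = 0 := by
    rw [Matrix.conjTranspose_eq_transpose_of_trivial, Matrix.transpose_mul,
      Matrix.transpose_transpose, Matrix.mul_assoc, ← Matrix.mul_assoc Nᵀ, ← hL,
      ← Matrix.mul_assoc, h0, Matrix.zero_mul]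
  have h2 := Matrix.self_mul_conjTranspose_eq_zero.mp h1
  rw [Matrix.sub_mul, Matrix.one_mul, sub_eq_zero] at h2
  rw [transferImpedance_eq, ← hN, ← hX, ← Matrix.mul_assoc, ← Matrix.mul_assoc, ← hL, h2]

/-! ### Hitting probabilities and their release -/

/-- A family `h v`, `v ∈ S`, of potentials which are harmonic off `S`, dual to the points of `S`
and form a subpartition of unity: hitting probabilities of the points of `S`. -/
structure HarmonicFamily (S : Finset V) (h : V → V → ℝ) : Prop where
  nonneg : ∀ v ∈ S, ∀ x, 0 ≤ h v x
  sum_le_one : ∀ x, ∑ v ∈ S, h v x ≤ 1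
  eval : ∀ v ∈ S, ∀ s ∈ S, h v s = if s = v then 1 else 0
  harmonic : ∀ v ∈ S, ∀ x, x ∉ S → (G.laplacian *ᵥ h v) x = 0
  offdiag : ∀ v ∈ S, ∀ u ∈ S, u ≠ v → (G.laplacian *ᵥ h v) u ≤ 0
  laplacian_sum : G.laplacian *ᵥ (∑ v ∈ S, h v) = 0

theorem laplacian_mulVec_single_offdiag {u v : V} (huv : u ≠ v) :
    (G.laplacian *ᵥ Pi.single v 1) u ≤ 0 := by
  have h := G.dotProduct_laplacian_mulVec (Pi.single u 1) (Pi.single v 1)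
  rw [single_one_dotProduct] at h
  rw [h, dotProduct]
  refine Finset.sum_nonpos fun e _ => ?_
  rw [weightedIncidence_mulVec, weightedIncidence_mulVec]
  have h2 : ((Pi.single u (1:ℝ) : V → ℝ) (G.src e) - (Pi.single u (1:ℝ) : V → ℝ) (G.tgt e)) *
      ((Pi.single v (1:ℝ) : V → ℝ) (G.src e) - (Pi.single v (1:ℝ) : V → ℝ) (G.tgt e)) ≤ 0 := by
    simp only [Pi.single_apply]
    split_ifs <;> simp_all
  nlinarith [Real.mul_self_sqrt (G.c_nonneg e), G.c_nonneg e,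
    mul_nonpos_of_nonneg_of_nonpos (G.c_nonneg e) h2]

theorem laplacian_mulVec_one : G.laplacian *ᵥ 1 = 0 := by
  have h : G.weightedIncidence *ᵥ (1 : V → ℝ) = 0 := by
    funext e
    rw [weightedIncidence_mulVec]
    simp
  rw [laplacian_eq, ← Matrix.mulVec_mulVec, h, Matrix.mulVec_zero]

theorem sum_single_one : ∑ v : V, (Pi.single v 1 : V → ℝ) = 1 := by
  funext x
  simp [Finset.sum_apply, Pi.single_apply]

theorem harmonicFamily_univ :
    G.HarmonicFamily Finset.univ fun v => Pi.single v 1 where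
  nonneg v _ x := by
    rw [Pi.single_apply]
    split_ifs <;> norm_num
  sum_le_one x := by simp [Pi.single_apply]
  eval v _ s _ := by rw [Pi.single_apply]
  harmonic v _ x hx := absurd (Finset.mem_univ x) hx
  offdiag v _ u _ huv := G.laplacian_mulVec_single_offdiag huv
  laplacian_sum := by
    rw [sum_single_one]
    exact G.laplacian_mulVec_one

end

namespace HarmonicFamily

variable {V E : Type*} [Fintype V] [DecidableEq V] [Fintype E] [DecidableEq E]
  {G : WeightedGraph V E} {S : Finset V} {h : V → V → ℝ}

theorem dotProduct_laplacian (H : G.HarmonicFamily S h) {v : V} (hv : v ∈ S) (p : V → ℝ) :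
    p ⬝ᵥ G.laplacian *ᵥ h v = ∑ s ∈ S, p s * (G.laplacian *ᵥ h v) s := by
  rw [dotProduct]
  refine (Finset.sum_subset (Finset.subset_univ S) fun x _ hx => ?_).symm
  rw [H.harmonic v hv x hx, mul_zero]

/-- The Gram matrix of the gradients is the Schur complement of L on S; its diagonal entries are the
squared norms |g_u|². -/
theorem inner_eq (H : G.HarmonicFamily S h) {u v : V} (hu : u ∈ S) (hv : v ∈ S) :
    (G.weightedIncidence *ᵥ h u) ⬝ᵥ (G.weightedIncidence *ᵥ h v) =
      (G.laplacian *ᵥ h v) u := by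
  rw [← dotProduct_laplacian_mulVec, H.dotProduct_laplacian hv, Finset.sum_eq_single_of_mem u hu]
  · rw [H.eval u hu u hu, if_pos rfl, one_mul]
  · intro s hs hsu
    rw [H.eval u hu s hs, if_neg hsu, zero_mul]

theorem laplacian_comm (H : G.HarmonicFamily S h) {u v : V} (hu : u ∈ S) (hv : v ∈ S) :
    (G.laplacian *ᵥ h v) u = (G.laplacian *ᵥ h u) v := by
  rw [← H.inner_eq hu hv, ← H.inner_eq hv hu, dotProduct_comm]

theorem diag_nonneg (H : G.HarmonicFamily S h) {u : V} (hu : u ∈ S) :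
    0 ≤ (G.laplacian *ᵥ h u) u := by
  rw [← H.inner_eq hu hu]
  exact Finset.sum_nonneg fun e _ => mul_self_nonneg _

theorem gradient_eq_zero (H : G.HarmonicFamily S h) {u : V} (hu : u ∈ S)
    (h0 : (G.laplacian *ᵥ h u) u = 0) : G.weightedIncidence *ᵥ h u = 0 := by
  rw [← H.inner_eq hu hu] at h0
  exact dotProduct_self_eq_zero.mp h0

theorem laplacian_eq_zero (H : G.HarmonicFamily S h) {u : V} (hu : u ∈ S)
    (h0 : (G.laplacian *ᵥ h u) u = 0) : G.laplacian *ᵥ h u = 0 := by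
  rw [laplacian_eq, ← Matrix.mulVec_mulVec, H.gradient_eq_zero hu h0, Matrix.mulVec_zero]

/-- The sum over `S` of the column of the Schur complement at `u` vanishes. -/
theorem sum_laplacian (H : G.HarmonicFamily S h) (u : V) :
    ∑ v ∈ S, (G.laplacian *ᵥ h v) u = 0 := by
  have := congrFun H.laplacian_sum u
  rwa [Matrix.mulVec_sum, Finset.sum_apply] at this

/-- The harmonic family obtained by releasing the point `u`. -/
noncomputable def release (G : WeightedGraph V E) (h : V → V → ℝ) (u v : V) : V → ℝ :=
  h v - ((G.laplacian *ᵥ h v) u / (G.laplacian *ᵥ h u) u) • h u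

theorem laplacian_release (u v x : V) : (G.laplacian *ᵥ release G h u v) x =
    (G.laplacian *ᵥ h v) x -
      (G.laplacian *ᵥ h v) u / (G.laplacian *ᵥ h u) u * (G.laplacian *ᵥ h u) x := by
  rw [release, Matrix.mulVec_sub, Matrix.mulVec_smul]
  rfl

theorem sum_release (H : G.HarmonicFamily S h) {u : V} (hu : u ∈ S) :
    ∑ v ∈ S.erase u, release G h u v =
      if (G.laplacian *ᵥ h u) u = 0 then ∑ v ∈ S.erase u, h v else ∑ v ∈ S, h v := by
  have h1 := H.sum_laplacian u
  rw [← Finset.add_sum_erase S _ hu] at h1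
  simp only [release, Finset.sum_sub_distrib, ← Finset.sum_smul, ← Finset.sum_div]
  split_ifs with h0
  · rw [h0, div_zero, zero_smul, sub_zero]
  · rw [eq_neg_of_add_eq_zero_right h1, neg_div, div_self h0, neg_one_smul, sub_neg_eq_add,
      Finset.sum_erase_add _ _ hu]

/-- Off-diagonal Schur entries are nonpositive, so releasing u adds nonnegative multiples of `h u`
to the other potentials. If the diagonal entry at u is zero, `h u` has zero gradient and division by
zero makes the release trivial. -/
theorem erase (H : G.HarmonicFamily S h) {u : V} (hu : u ∈ S) :
    G.HarmonicFamily (S.erase u) (release G h u) where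
  nonneg v hv x := by
    obtain ⟨hvu, hvS⟩ := Finset.mem_erase.mp hv
    have h1 := div_nonpos_of_nonpos_of_nonneg (H.offdiag v hvS u hu hvu.symm) (H.diag_nonneg hu)
    have h2 := mul_nonpos_of_nonpos_of_nonneg h1 (H.nonneg u hu x)
    have h3 := H.nonneg v hvS x
    simp only [release, Pi.sub_apply, Pi.smul_apply, smul_eq_mul]
    linarith
  sum_le_one x := by
    have h1 := congrFun (H.sum_release hu) x
    rw [Finset.sum_apply] at h1
    rw [h1]
    have h2 := H.sum_le_one x
    split_ifs
    · rw [Finset.sum_apply]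
      rw [← Finset.add_sum_erase S _ hu] at h2
      linarith [H.nonneg u hu x]
    · rwa [Finset.sum_apply]
  eval v hv s hs := by
    obtain ⟨hvu, hvS⟩ := Finset.mem_erase.mp hv
    obtain ⟨hsu, hsS⟩ := Finset.mem_erase.mp hs
    simp only [release, Pi.sub_apply, Pi.smul_apply, smul_eq_mul]
    rw [H.eval u hu s hsS, if_neg hsu, mul_zero, sub_zero, H.eval v hvS s hsS]
  harmonic v hv x hx := by
    obtain ⟨hvu, hvS⟩ := Finset.mem_erase.mp hv
    rw [laplacian_release]
    by_cases hxu : x = u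
    · subst hxu
      by_cases h0 : (G.laplacian *ᵥ h x) x = 0
      · rw [h0, H.laplacian_comm hu hvS, H.laplacian_eq_zero hu h0]
        simp
      · rw [div_mul_cancel₀ _ h0, sub_self]
    · have hxS : x ∉ S := fun hxS => hx (Finset.mem_erase.mpr ⟨hxu, hxS⟩)
      rw [H.harmonic v hvS x hxS, H.harmonic u hu x hxS, mul_zero, sub_zero]
  offdiag v hv w hw hwv := by
    obtain ⟨hvu, hvS⟩ := Finset.mem_erase.mp hv
    obtain ⟨hwu, hwS⟩ := Finset.mem_erase.mp hw
    rw [laplacian_release]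
    have h1 := div_nonpos_of_nonpos_of_nonneg (H.offdiag v hvS u hu hvu.symm) (H.diag_nonneg hu)
    have h2 := mul_nonneg_of_nonpos_of_nonpos h1 (H.offdiag u hu w hwS hwu)
    linarith [H.offdiag v hvS w hwS hwv]
  laplacian_sum := by
    rw [H.sum_release hu]
    split_ifs with h0
    · have h1 := H.laplacian_sum
      rw [← Finset.add_sum_erase S _ hu, Matrix.mulVec_add, H.laplacian_eq_zero hu h0,
        zero_add] at h1
      exact h1
    · exact H.laplacian_sum

theorem gradient_release (H : G.HarmonicFamily S h) {u v : V} (hu : u ∈ S) (hv : v ∈ S) :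
    G.weightedIncidence *ᵥ release G h u v = G.weightedIncidence *ᵥ h v -
      (((G.weightedIncidence *ᵥ h u) ⬝ᵥ (G.weightedIncidence *ᵥ h v)) /
        (G.laplacian *ᵥ h u) u) • G.weightedIncidence *ᵥ h u := by
  rw [release, Matrix.mulVec_sub, Matrix.mulVec_smul, H.inner_eq hu hv]

end HarmonicFamily
end WeightedGraph

/-! ### Projections and entrywise absolute values -/

/-- The columns of `Q` lie in the span of the vectors `g v`, `v ∈ S`, which are fixed by `Qᵀ`. -/
structure IsProjectionOnSpan {V E : Type*} [Fintype E] (S : Finset V) (g : V → E → ℝ)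
    (Q : Matrix E E ℝ) : Prop where
  mem_span : ∀ f, (fun e => Q e f) ∈ Submodule.span ℝ (g '' (S : Set V))
  vecMul_eq : ∀ v ∈ S, g v ᵥ* Q = g v

/-- The component of `w` orthogonal to `a`, as a linear map. -/
noncomputable def orthogonalComponent {E : Type*} [Fintype E] (a : E → ℝ) :
    (E → ℝ) →ₗ[ℝ] (E → ℝ) where
  toFun w := w - ((a ⬝ᵥ w) / (a ⬝ᵥ a)) • a
  map_add' w z := by
    rw [dotProduct_add, add_div, add_smul]
    abel
  map_smul' r w := by
    rw [dotProduct_smul, smul_eq_mul, mul_div_assoc, ← smul_smul, RingHom.id_apply, smul_sub]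

theorem orthogonalComponent_apply {E : Type*} [Fintype E] (a w : E → ℝ) :
    orthogonalComponent a w = w - ((a ⬝ᵥ w) / (a ⬝ᵥ a)) • a :=
  rfl

theorem orthogonalComponent_self {E : Type*} [Fintype E] (a : E → ℝ) :
    orthogonalComponent a a = 0 := by
  rw [orthogonalComponent_apply]
  by_cases h : a ⬝ᵥ a = 0
  · rw [dotProduct_self_eq_zero.mp h, smul_zero, sub_zero]
  · rw [div_self h, one_smul, sub_self]

/-- The two conditions force QᵀQ = Q, so Q is the orthogonal projection onto the span. Removing the
direction g_u maps each column to its component orthogonal to g_u, and g_u itself to 0, so u drops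
out of the spanning set. -/
theorem IsProjectionOnSpan.erase {V E : Type*} [DecidableEq V] [Fintype E] {S : Finset V}
    {g : V → E → ℝ} {Q : Matrix E E ℝ} (hQ : IsProjectionOnSpan S g Q) {u : V} (hu : u ∈ S) :
    IsProjectionOnSpan (S.erase u) (fun v => orthogonalComponent (g u) (g v))
      (Q - (g u ⬝ᵥ g u)⁻¹ • Matrix.vecMulVec (g u) (g u)) where
  mem_span f := by
    have hf : (fun e => (Q - (g u ⬝ᵥ g u)⁻¹ • Matrix.vecMulVec (g u) (g u)) e f) =
        orthogonalComponent (g u) (fun e => Q e f) := by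
      have h1 : g u ⬝ᵥ (fun e => Q e f) = g u f := congrFun (hQ.vecMul_eq u hu) f
      funext e
      rw [orthogonalComponent_apply, h1]
      simp only [Matrix.sub_apply, Matrix.smul_apply, Matrix.vecMulVec_apply, Pi.sub_apply,
        Pi.smul_apply, smul_eq_mul]
      ring
    rw [hf]
    refine Submodule.span_induction ?_ ?_ ?_ ?_ (hQ.mem_span f)
    · rintro _ ⟨v, hv, rfl⟩
      by_cases hvu : v = u
      · rw [hvu, orthogonalComponent_self]
        exact Submodule.zero_mem _
      · exact Submodule.subset_span ⟨v, Finset.mem_coe.mpr (Finset.mem_erase.mpr ⟨hvu, hv⟩), rfl⟩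
    · rw [map_zero]
      exact Submodule.zero_mem _
    · intro x y _ _ hx hy
      rw [map_add]
      exact Submodule.add_mem _ hx hy
    · intro r x _ hx
      rw [map_smul]
      exact Submodule.smul_mem _ r hx
  vecMul_eq v hv := by
    have h1 : orthogonalComponent (g u) (g v) ᵥ* Q = orthogonalComponent (g u) (g v) := by
      rw [orthogonalComponent_apply, Matrix.sub_vecMul, Matrix.smul_vecMul,
        hQ.vecMul_eq v (Finset.mem_of_mem_erase hv), hQ.vecMul_eq u hu]
    have h2 : orthogonalComponent (g u) (g v) ⬝ᵥ g u = 0 := by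
      rw [orthogonalComponent_apply, sub_dotProduct, smul_dotProduct, smul_eq_mul]
      by_cases h : g u ⬝ᵥ g u = 0
      · rw [dotProduct_self_eq_zero.mp h, dotProduct_zero, dotProduct_zero, mul_zero, sub_zero]
      · rw [div_mul_cancel₀ _ h, dotProduct_comm, sub_self]
    rw [Matrix.vecMul_sub, h1, Matrix.vecMul_smul, Matrix.vecMul_vecMulVec, h2, zero_smul,
      smul_zero, sub_zero]

/-- The bilinear form of the entrywise absolute value of `Q`. -/
def absForm {E : Type*} [Fintype E] (Q : Matrix E E ℝ) (x y : E → ℝ) : ℝ :=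
  ∑ e, ∑ f, |Q e f| * (x e * y f)

theorem absForm_le_add_vecMulVec {E : Type*} [Fintype E] (Q : Matrix E E ℝ) (r : ℝ) (hr : 0 ≤ r)
    (a x y : E → ℝ) (hx : ∀ e, 0 ≤ x e) (hy : ∀ e, 0 ≤ y e) :
    absForm Q x y ≤ absForm (Q - r • Matrix.vecMulVec a a) x y +
      r * ((∑ e, |a e| * x e) * ∑ e, |a e| * y e) := by
  rw [Finset.sum_mul_sum, Finset.mul_sum, absForm, absForm, ← Finset.sum_add_distrib]
  refine Finset.sum_le_sum fun e _ => ?_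
  rw [Finset.mul_sum, ← Finset.sum_add_distrib]
  refine Finset.sum_le_sum fun f _ => ?_
  have h1 : |Q e f| ≤ |(Q - r • Matrix.vecMulVec a a) e f| + r * (|a e| * |a f|) := by
    have h2 := abs_add_le ((Q - r • Matrix.vecMulVec a a) e f) (r * (a e * a f))
    rw [abs_mul r, abs_of_nonneg hr, abs_mul] at h2
    refine le_trans (le_of_eq ?_) h2
    simp [Matrix.vecMulVec_apply]
  calc |Q e f| * (x e * y f)
      ≤ (|(Q - r • Matrix.vecMulVec a a) e f| + r * (|a e| * |a f|)) * (x e * y f) :=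
        mul_le_mul_of_nonneg_right h1 (mul_nonneg (hx e) (hy f))
    _ = _ := by ring

/-- A bound for the bilinear form of `|Q|` on nonnegative vectors bounds its spectral norm. -/
theorem norm_map_abs_le {E : Type*} [Fintype E] [DecidableEq E] (Q : Matrix E E ℝ) (c : ℝ)
    (hc : 0 < c) (H : ∀ x y : E → ℝ, (∀ e, 0 ≤ x e) → (∀ e, 0 ≤ y e) →
      absForm Q x y ≤ c * ((∑ e, x e ^ 2 + ∑ e, y e ^ 2) / 2)) :
    ‖Q.map fun t => |t|‖ ≤ c := by
  rw [Matrix.l2_opNorm_def]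
  refine ContinuousLinearMap.opNorm_le_bound _ hc.le fun z => ?_
  have hz : ∀ w : EuclideanSpace ℝ E, ‖w‖ ^ 2 = ∑ e, w e ^ 2 := EuclideanSpace.real_norm_sq_eq
  set M := Q.map fun t => |t| with hM
  set w := (Matrix.toEuclideanLin (𝕜 := ℝ) (m := E) (n := E) ≪≫ₗ LinearMap.toContinuousLinearMap) M z
    with hw
  have hwe : ∀ e, w e = ∑ f, |Q e f| * z f := fun e => rfl
  -- The scaling by 1/c balances the hypothesis: it gives ‖w‖² ≤ ‖w‖²/2 + (c‖z‖)²/2, and half of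
  -- ‖w‖² is absorbed.
  have h1 : ‖w‖ ^ 2 ≤ c * absForm Q (fun e => |w e| / c) (fun f => |z f|) := by
    rw [hz, absForm, Finset.mul_sum]
    refine Finset.sum_le_sum fun e _ => ?_
    have h2 : |w e| ≤ ∑ f, |Q e f| * |z f| := by
      rw [hwe]
      refine (Finset.abs_sum_le_sum_abs _ _).trans (le_of_eq ?_)
      simp only [abs_mul, abs_abs]
    calc w e ^ 2 = |w e| * |w e| := by rw [← sq, sq_abs]
      _ ≤ |w e| * ∑ f, |Q e f| * |z f| := mul_le_mul_of_nonneg_left h2 (abs_nonneg _)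
      _ = c * ∑ f, |Q e f| * (|w e| / c * |z f|) := by
        rw [Finset.mul_sum, Finset.mul_sum]
        refine Finset.sum_congr rfl fun f _ => ?_
        field_simp
  have h3 := H (fun e => |w e| / c) (fun f => |z f|) (fun e => by positivity)
    (fun e => abs_nonneg _)
  simp only [sq_abs, div_pow, ← Finset.sum_div] at h3
  rw [← hz, ← hz] at h3
  have h4 : ‖w‖ ^ 2 ≤ (c * ‖z‖) ^ 2 := by
    have h5 := h1.trans (mul_le_mul_of_nonneg_left h3 hc.le)
    have h6 : c * (c * ((‖w‖ ^ 2 / c ^ 2 + ‖z‖ ^ 2) / 2)) =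
        ‖w‖ ^ 2 / 2 + (c * ‖z‖) ^ 2 / 2 := by
      field_simp
    linarith
  exact (sq_le_sq₀ (norm_nonneg _) (by positivity)).mp h4

/-! ### The logarithmic energy estimate -/

/-- A discrete chain rule for the concave function `t ↦ log (t + ε)`. -/
theorem sq_sub_div_le_log_sub {a b ε : ℝ} (ha : 0 ≤ a) (hb : 0 ≤ b) (hε : 0 < ε) :
    (a - b) ^ 2 / (a + b + ε) ≤ (a - b) * (Real.log (a + ε) - Real.log (b + ε)) := by
  wlog hab : b ≤ a generalizing a b
  · have := this hb ha (le_of_not_ge hab)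
    rw [show (a - b) ^ 2 = (b - a) ^ 2 by ring, show a + b + ε = b + a + ε by ring]
    linarith
  have h1 : 1 - (b + ε) / (a + ε) ≤ Real.log (a + ε) - Real.log (b + ε) := by
    rw [← Real.log_div (by positivity) (by positivity), ← inv_div (a + ε) (b + ε)]
    exact Real.one_sub_inv_le_log_of_pos (by positivity)
  have h2 : (a - b) / (a + b + ε) ≤ 1 - (b + ε) / (a + ε) := by
    have : 1 - (b + ε) / (a + ε) = (a - b) / (a + ε) := by
      field_simp
      ring
    rw [this]
    exact div_le_div_of_nonneg_left (by linarith) (by positivity) (by linarith)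
  rw [sq, mul_div_assoc]
  exact mul_le_mul_of_nonneg_left (h2.trans h1) (by linarith)

namespace WeightedGraph
namespace HarmonicFamily

variable {V E : Type*} [Fintype V] [DecidableEq V] [Fintype E] [DecidableEq E]
  {G : WeightedGraph V E} {S : Finset V} {h : V → V → ℝ}

/-- The discrete coarea estimate for the hitting probability `h u`. -/
theorem sum_gradient_sq_div_le (H : G.HarmonicFamily S h) {u : V} (hu : u ∈ S) {ε : ℝ}
    (hε : 0 < ε) :
    ∑ e, (G.weightedIncidence *ᵥ h u) e ^ 2 / (h u (G.src e) + h u (G.tgt e) + ε) ≤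
      Real.log (1 / ε + 1) * (G.laplacian *ᵥ h u) u := by
  set φ : V → ℝ := fun x => Real.log (h u x + ε) with hφ
  have h1 : φ ⬝ᵥ G.laplacian *ᵥ h u = Real.log (1 / ε + 1) * (G.laplacian *ᵥ h u) u := by
    have h2 : ∑ s ∈ S, (G.laplacian *ᵥ h u) s = 0 := by
      rw [← H.sum_laplacian u]
      exact Finset.sum_congr rfl fun s hs => H.laplacian_comm hs hu
    -- On S, φ is log ε plus a jump of log(1/ε + 1) at u; the constant part is killed by the zero
    -- column sum `h2`.
    have h3 : ∀ s ∈ S, φ s * (G.laplacian *ᵥ h u) s =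
        Real.log ε * (G.laplacian *ᵥ h u) s +
          if s = u then Real.log (1 / ε + 1) * (G.laplacian *ᵥ h u) u else 0 := by
      intro s hs
      simp only [hφ]
      rw [H.eval u hu s hs]
      split_ifs with hsu
      · rw [hsu, ← add_mul, ← Real.log_mul hε.ne' (by positivity)]
        congr 2
        field_simp
      · rw [zero_add, add_zero]
    rw [H.dotProduct_laplacian hu, Finset.sum_congr rfl h3, Finset.sum_add_distrib,
      ← Finset.mul_sum, h2, mul_zero, zero_add, Finset.sum_ite_eq' S u, if_pos hu]
  rw [← h1, dotProduct_laplacian_mulVec]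
  refine Finset.sum_le_sum fun e _ => ?_
  rw [weightedIncidence_mulVec, weightedIncidence_mulVec, mul_pow, Real.sq_sqrt (G.c_nonneg e),
    mul_div_assoc]
  have h4 := mul_le_mul_of_nonneg_left (sq_sub_div_le_log_sub (H.nonneg u hu (G.src e))
    (H.nonneg u hu (G.tgt e)) hε) (G.c_nonneg e)
  refine h4.trans (le_of_eq ?_)
  nth_rewrite 1 [← Real.mul_self_sqrt (G.c_nonneg e)]
  ring

/-- The normalised absolute gradients of a harmonic family form an operator of norm
`O(√log n)`. -/
theorem sum_sq_abs_gradient_le [Nonempty V] (H : G.HarmonicFamily S h) (x : E → ℝ) :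
    ∑ u ∈ S, ((G.laplacian *ᵥ h u) u)⁻¹ * (∑ e, |(G.weightedIncidence *ᵥ h u) e| * x e) ^ 2 ≤
      3 * Real.log (Fintype.card V + 1) * ∑ e, x e ^ 2 := by
  obtain ⟨n, hn⟩ : ∃ n : ℝ, n = (Fintype.card V : ℝ) := ⟨_, rfl⟩
  rw [← hn]
  have hn0 : 0 < n := hn ▸ Nat.cast_pos.mpr Fintype.card_pos
  have hlog : 0 ≤ Real.log (n + 1) := Real.log_nonneg (by linarith)
  have h1 : ∀ u ∈ S, ((G.laplacian *ᵥ h u) u)⁻¹ *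
      (∑ e, |(G.weightedIncidence *ᵥ h u) e| * x e) ^ 2 ≤
      Real.log (n + 1) * ∑ e, (h u (G.src e) + h u (G.tgt e) + 1 / n) * x e ^ 2 := by
    intro u hu
    have hm : ∀ e, 0 < h u (G.src e) + h u (G.tgt e) + 1 / n := fun e => by
      have := H.nonneg u hu (G.src e)
      have := H.nonneg u hu (G.tgt e)
      positivity
    have h2 : 0 ≤ ∑ e, (h u (G.src e) + h u (G.tgt e) + 1 / n) * x e ^ 2 :=
      Finset.sum_nonneg fun e _ => mul_nonneg (hm e).le (sq_nonneg _)
    have h3 := H.sum_gradient_sq_div_le hu (one_div_pos.mpr hn0)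
    rw [one_div_one_div] at h3
    have h4 : (∑ e, |(G.weightedIncidence *ᵥ h u) e| * x e) ^ 2 ≤
        (∑ e, (G.weightedIncidence *ᵥ h u) e ^ 2 / (h u (G.src e) + h u (G.tgt e) + 1 / n)) *
          ∑ e, (h u (G.src e) + h u (G.tgt e) + 1 / n) * x e ^ 2 := by
      refine Finset.sum_sq_le_sum_mul_sum_of_sq_le_mul _
        (fun e _ => div_nonneg (sq_nonneg _) (hm e).le)
        (fun e _ => mul_nonneg (hm e).le (sq_nonneg _)) fun e _ => ?_
      rw [mul_pow, sq_abs, ← mul_assoc, div_mul_cancel₀ _ (hm e).ne']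
    rcases (H.diag_nonneg hu).eq_or_lt with h0 | h0
    · rw [← h0, inv_zero, zero_mul]
      positivity
    · rw [inv_mul_le_iff₀ h0]
      calc _ ≤ _ := h4.trans (mul_le_mul_of_nonneg_right h3 h2)
        _ = _ := by ring
  refine (Finset.sum_le_sum h1).trans ?_
  rw [← Finset.mul_sum, Finset.sum_comm, mul_comm (3 : ℝ), mul_assoc,
    Finset.mul_sum Finset.univ (fun e => x e ^ 2) (3 : ℝ)]
  refine mul_le_mul_of_nonneg_left (Finset.sum_le_sum fun e _ => ?_) hlog
  rw [← Finset.sum_mul]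
  refine mul_le_mul_of_nonneg_right ?_ (sq_nonneg _)
  rw [Finset.sum_add_distrib, Finset.sum_add_distrib, Finset.sum_const, nsmul_eq_mul]
  -- With ε = 1/n the regularisation contributes at most 1; the two endpoints contribute at most 1
  -- each, whence the constant 3.
  have h5 : (S.card : ℝ) * (1 / n) ≤ 1 := by
    rw [mul_one_div, div_le_one hn0]
    exact hn ▸ Nat.cast_le.mpr (Finset.card_le_univ S)
  linarith [H.sum_le_one (G.src e), H.sum_le_one (G.tgt e)]

/-! ### Averaging over the released point -/

/-- Averaging over the point of `S` which is released first. -/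
theorem absForm_le [Nonempty V] (x y : E → ℝ) (hx : ∀ e, 0 ≤ x e) (hy : ∀ e, 0 ≤ y e) (k : ℕ) :
    ∀ (S : Finset V) (h : V → V → ℝ) (Q : Matrix E E ℝ), S.card = k + 1 →
      G.HarmonicFamily S h → IsProjectionOnSpan S (fun v => G.weightedIncidence *ᵥ h v) Q →
      absForm Q x y ≤ 3 * Real.log (Fintype.card V + 1) * ((_root_.harmonic (k + 1) : ℝ) - 1) *
        ((∑ e, x e ^ 2 + ∑ e, y e ^ 2) / 2) := by
  induction k with
  | zero =>
    intro S h Q hS H hQ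
    obtain ⟨v, rfl⟩ := Finset.card_eq_one.mp hS
    -- A single grounded point has zero energy because its column sum vanishes, so Q = 0. This
    -- accounts for the `- 1` after the harmonic number.
    have h0 : G.weightedIncidence *ᵥ h v = 0 := by
      refine H.gradient_eq_zero (Finset.mem_singleton_self v) ?_
      have := H.sum_laplacian v
      rwa [Finset.sum_singleton] at this
    have hQ0 : ∀ e f, Q e f = 0 := by
      intro e f
      have := hQ.mem_span f
      rw [Finset.coe_singleton, Set.image_singleton, h0, Submodule.span_zero_singleton,
        Submodule.mem_bot] at this
      exact congrFun this e
    simp [absForm, hQ0]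
  | succ k ih =>
    intro S h Q hS H hQ
    set Λ := 3 * Real.log (Fintype.card V + 1) with hΛ
    set X := ∑ e, x e ^ 2
    set Y := ∑ e, y e ^ 2
    have h1 : ∀ u ∈ S, absForm Q x y ≤ Λ * ((_root_.harmonic (k + 1) : ℝ) - 1) * ((X + Y) / 2) +
        (((G.laplacian *ᵥ h u) u)⁻¹ * (∑ e, |(G.weightedIncidence *ᵥ h u) e| * x e) ^ 2 +
          ((G.laplacian *ᵥ h u) u)⁻¹ * (∑ e, |(G.weightedIncidence *ᵥ h u) e| * y e) ^ 2) / 2 := by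
      intro u hu
      have hr := inv_nonneg.mpr (H.diag_nonneg hu)
      have hQ' := hQ.erase hu
      have hg : ∀ v ∈ S.erase u, orthogonalComponent (G.weightedIncidence *ᵥ h u)
          (G.weightedIncidence *ᵥ h v) = G.weightedIncidence *ᵥ release G h u v := by
        intro v hv
        rw [H.gradient_release hu (Finset.mem_of_mem_erase hv), orthogonalComponent_apply,
          H.inner_eq hu hu]
      rw [H.inner_eq hu hu] at hQ'
      have hQ'' : IsProjectionOnSpan (S.erase u)
          (fun v => G.weightedIncidence *ᵥ release G h u v)
          (Q - ((G.laplacian *ᵥ h u) u)⁻¹ • Matrix.vecMulVec (G.weightedIncidence *ᵥ h u)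
            (G.weightedIncidence *ᵥ h u)) := by
        refine ⟨fun f => ?_, fun v hv => ?_⟩
        · rw [← Set.image_congr fun v hv => hg v (Finset.mem_coe.mp hv)]
          exact hQ'.mem_span f
        · rw [← hg v hv]
          exact hQ'.vecMul_eq v hv
      have h2 := ih _ _ _ (by rw [Finset.card_erase_of_mem hu, hS]; rfl) (H.erase hu) hQ''
      have h3 := absForm_le_add_vecMulVec Q _ hr (G.weightedIncidence *ᵥ h u) x y hx hy
      have h4 := mul_le_mul_of_nonneg_left (two_mul_le_add_sq
        (∑ e, |(G.weightedIncidence *ᵥ h u) e| * x e)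
        (∑ e, |(G.weightedIncidence *ᵥ h u) e| * y e)) hr
      linarith
    -- The left side and the inductive bound do not depend on u, so summing over the k + 2 points
    -- and dividing adds exactly the next harmonic term.
    have h2 := Finset.sum_le_sum h1
    rw [Finset.sum_const, Finset.sum_add_distrib, Finset.sum_const, ← Finset.sum_div,
      Finset.sum_add_distrib, hS, nsmul_eq_mul, nsmul_eq_mul] at h2
    have hX := H.sum_sq_abs_gradient_le x
    have hY := H.sum_sq_abs_gradient_le y
    have hk : (0 : ℝ) < ((k + 1 + 1 : ℕ) : ℝ) := by positivity
    rw [harmonic_succ]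
    push_cast at h2 hk ⊢
    refine le_of_mul_le_mul_left (h2.trans ?_) hk
    have h5 : ((k : ℝ) + 1 + 1) * (Λ * ((_root_.harmonic (k + 1) : ℝ) + ((k : ℝ) + 1 + 1)⁻¹ - 1) *
        ((X + Y) / 2)) = ((k : ℝ) + 1 + 1) * (Λ * ((_root_.harmonic (k + 1) : ℝ) - 1) * ((X + Y) / 2)) +
          (Λ * X + Λ * Y) / 2 := by
      field_simp
      ring
    rw [h5]
    linarith

end HarmonicFamily

/-! ### Conclusion for Π -/

theorem isProjectionOnSpan_transferImpedance {V E : Type*} [Fintype V] [DecidableEq V]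
    [Fintype E] [DecidableEq E] (G : WeightedGraph V E) :
    IsProjectionOnSpan Finset.univ (fun v => G.weightedIncidence *ᵥ Pi.single v 1)
      G.transferImpedance where
  mem_span f := by
    have h1 : (fun e => G.transferImpedance e f) = G.weightedIncidence *ᵥ
        (fun v => (pseudoInverse G.laplacian * G.weightedIncidenceᵀ) v f) := by
      rw [transferImpedance_eq, Matrix.mul_assoc]
      rfl
    rw [h1, Matrix.mulVec_eq_sum]
    refine Submodule.sum_mem _ fun v _ => ?_
    rw [op_smul_eq_smul]
    refine Submodule.smul_mem _ _ (Submodule.subset_span ⟨v, Finset.mem_coe.mpr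
      (Finset.mem_univ v), ?_⟩)
    simp only [Matrix.mulVec_single_one]
    rfl
  vecMul_eq v _ := by
    have h1 : G.weightedIncidence *ᵥ Pi.single v 1 = Pi.single v 1 ᵥ* G.weightedIncidenceᵀ := by
      rw [Matrix.vecMul_transpose]
    rw [h1, Matrix.vecMul_vecMul, transpose_weightedIncidence_mul_transferImpedance]

end WeightedGraph

/-- There is an absolute constant `K` such that for every weighted graph on `n` vertices the
spectral norm (the `ℓ²` operator norm) of the entrywise absolute value of its weighted transfer
impedance matrix is at most `K (log n)²`. -/
theorem mainTheorem1 :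
    ∃ K : ℝ, ∀ (V E : Type*) [Fintype V] [DecidableEq V] [Fintype E] [DecidableEq E]
      (G : WeightedGraph V E),
      ‖G.absTransferImpedance‖ ≤ K * Real.log (Fintype.card V) ^ 2 := by
  -- 6 = 3 · 2, from log(n+1) ≤ 2 log n and H_n - 1 ≤ log n for n ≥ 2.
  refine ⟨6, fun V E _ _ _ _ G => ?_⟩
  by_cases hn : 2 ≤ Fintype.card V
  · have hn' : (2 : ℝ) ≤ Fintype.card V := by exact_mod_cast hn
    have : Nonempty V := Fintype.card_pos_iff.mp (by lia)
    have hl : 0 < Real.log (Fintype.card V) := Real.log_pos (by linarith)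
    have h1 : Real.log (Fintype.card V + 1) ≤ 2 * Real.log (Fintype.card V) := by
      rw [← Real.log_rpow (by linarith) 2, Real.rpow_two]
      exact Real.log_le_log (by linarith) (by nlinarith)
    have h2 : (harmonic (Fintype.card V) : ℝ) - 1 ≤ Real.log (Fintype.card V) := by
      linarith [harmonic_le_one_add_log (Fintype.card V)]
    refine norm_map_abs_le _ _ (by positivity) fun x y hx hy => ?_
    obtain ⟨k, hk⟩ : ∃ k, Fintype.card V = k + 1 := ⟨Fintype.card V - 1, by lia⟩
    have h3 := WeightedGraph.HarmonicFamily.absForm_le x y hx hy k Finset.univ _ _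
      (by rw [Finset.card_univ, hk]) G.harmonicFamily_univ G.isProjectionOnSpan_transferImpedance
    rw [← hk] at h3
    refine h3.trans (mul_le_mul_of_nonneg_right ?_ (by positivity))
    have h4 : 0 ≤ Real.log (Fintype.card V + 1) := Real.log_nonneg (by linarith)
    calc 3 * Real.log (Fintype.card V + 1) * ((harmonic (Fintype.card V) : ℝ) - 1)
        ≤ 3 * Real.log (Fintype.card V + 1) * Real.log (Fintype.card V) :=
          mul_le_mul_of_nonneg_left h2 (by linarith)
      _ ≤ 3 * (2 * Real.log (Fintype.card V)) * Real.log (Fintype.card V) :=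
          mul_le_mul_of_nonneg_right (by linarith) hl.le
      _ = 6 * Real.log (Fintype.card V) ^ 2 := by ring
  -- For n ≤ 1 the logarithm is 0, but every edge is a loop, so B and hence Π vanish.
  · have : Subsingleton V := Fintype.card_le_one_iff_subsingleton.mp (by lia)
    have h0 : G.absTransferImpedance = 0 := by
      have hB : G.incidence = 0 := by
        ext e x
        simp [WeightedGraph.incidence, Subsingleton.elim (G.src e) (G.tgt e)]
      ext e f
      simp [WeightedGraph.absTransferImpedance, WeightedGraph.transferImpedance, hB]
    rw [h0, norm_zero]
    positivity
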